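/- Let $\mu_1,\mu_2\in\mathbb R^d$, let $\Sigma\in\mathbb R^{d\times d}$ be symmetric positive semidefinite (possibly singular), and let $\varepsilon\ge 0$. A labelled sample $(x,y)$ is drawn from the balanced mixture: $P(y=1)=P(y=-1)=\tfrac12$, $x\mid y=1\sim\mathcal N(\mu_1,\Sigma)$, $x\mid y=-1\sim\mathcal N(\mu_2,\Sigma)$. For a linear classifier $\hat y(x)=\mathrm{sign}(w^\top x-b)$ (with $\mathrm{sign}(0)=0$) let $a=P(\hat y(x)=y)$ be its standard accuracy, $P(\exists\,\delta:\ \|\delta\|_2\le\varepsilon,\ \hat y(x+\delta)\ne y)$ its robust error, $\|\delta_x\|_2=\inf\{\|\delta\|_2:\hat y(x+\delta)\neq\hat y(x)\}$ its margin at $x$, and $$\|\bar\delta_x\|_2=\|\delta_x\|_2\cdot\frac{\|w\|_2}{\left|w^\top\frac{\mu_1-\mu_2}{2}\right|}$$ its scaled margin. Let $\Phi$ and $\varphi$ be the distribution function and the density of $\mathcal N(0,1)$. The classifier is called robust Bayes optimal (for the $\ell_2$ budget $\varepsilon$) if it minimizes the robust error among all linear classifiers. (i) If $\varepsilon<\left\|\frac{\mu_1-\mu_2}{2}\right\|_2$,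 then every robust Bayes optimal linear classifier has $a>\frac12$, its scaled margin is integrable over the correctly classified samples, and, if $a<1$ (so that $\Phi^{-1}(a)$ is defined), $$\mathbb E\big[\|\bar\delta_x\|_2\,\big|\,\hat y(x)=y\big]\ \ge\ 1+\frac{\varphi(\Phi^{-1}(a))}{a\,\Phi^{-1}(a)}=1+\frac{1}{\sqrt{2\pi}}\,\frac{1}{a\,\Phi^{-1}(a)}\,e^{-\frac12(\Phi^{-1}(a))^2}.$$ (ii) Let $\Sigma=F\Lambda F^\top$ be any economy-size eigendecomposition ($F^\top F=I$, $\Lambda$ diagonal with nonzero diagonal entries), let $\tilde\mu=F^\top\frac{\mu_1-\mu_2}{2}$, suppose $\varepsilon<\|\tilde\mu\|_2$, and let $z$ minimize $(\tilde\mu-z)^\top\Lambda^{-1}(\tilde\mu-z)$ over $\|z\|_2\le\varepsilon$. Then the linear classifier $$\hat y^*(x)=\mathrm{sign}\Big(\big(x-\tfrac{\mu_1+\mu_2}{2}\big)^\top F\Lambda^{-1}(\tilde\mu-z)\Big)$$ has $\frac12<a<1$, its scaled margin is integrable over the correctly classified samples, and it satisfies the same inequality. If moreover $\mu_1-\mu_2$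 lies in the range of $\Sigma$ (in particular if $\Sigma$ is invertible), then $\hat y^*$ is robust Bayes optimal. -/

import Mathlib

open MeasureTheory ProbabilityTheory
open scoped ENNReal RealInnerProductSpace

/-- The law of a labelled sample `(x, y)`: the label `y` is `1` or `-1` with probability `1/2` each,
and `x` given `y = 1` is `N(μ₁, S)`, while `x` given `y = -1` is `N(μ₂, S)`. -/
noncomputable def dataLaw {d : ℕ} (μ₁ μ₂ : EuclideanSpace ℝ (Fin d))
    (S : Matrix (Fin d) (Fin d) ℝ) : Measure (EuclideanSpace ℝ (Fin d) × ℝ) :=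
  (2⁻¹ : ℝ≥0∞) • (multivariateGaussian μ₁ S).map (fun x => (x, (1 : ℝ))) +
    (2⁻¹ : ℝ≥0∞) • (multivariateGaussian μ₂ S).map (fun x => (x, (-1 : ℝ)))

/-- A linear classifier on `ℝᵈ`, given by its weight vector and its threshold. -/
structure LinearClassifier (d : ℕ) where
  weight : EuclideanSpace ℝ (Fin d)
  threshold : ℝ

namespace LinearClassifier

variable {d : ℕ}

/-- The predicted label `sign (wᵀ x - b)`, with `sign 0 = 0`. -/
noncomputable def predict (c : LinearClassifier d) (x : EuclideanSpace ℝ (Fin d)) : ℝ :=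
  Real.sign (⟪c.weight, x⟫ - c.threshold)

/-- The event that the sample `(x, y)` is classified correctly. -/
def correct (c : LinearClassifier d) : Set (EuclideanSpace ℝ (Fin d) × ℝ) :=
  {p | c.predict p.1 = p.2}

/-- Standard accuracy: the probability that a sample is classified correctly. -/
noncomputable def accuracy (c : LinearClassifier d) (μ₁ μ₂ : EuclideanSpace ℝ (Fin d))
    (S : Matrix (Fin d) (Fin d) ℝ) : ℝ :=
  (dataLaw μ₁ μ₂ S).real c.correct

/-- Robust classification error: the probability that some perturbation of `x` of Euclidean norm at
most `ε` receives a label other than the true label `y`. -/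
noncomputable def robustError (c : LinearClassifier d) (μ₁ μ₂ : EuclideanSpace ℝ (Fin d))
    (S : Matrix (Fin d) (Fin d) ℝ) (ε : ℝ) : ℝ :=
  (dataLaw μ₁ μ₂ S).real
    {p | ∃ δ : EuclideanSpace ℝ (Fin d), ‖δ‖ ≤ ε ∧ c.predict (p.1 + δ) ≠ p.2}

/-- A linear classifier is robust Bayes optimal if no linear classifier has a smaller robust
classification error. -/
def IsRobustBayesOptimal (c : LinearClassifier d) (μ₁ μ₂ : EuclideanSpace ℝ (Fin d))
    (S : Matrix (Fin d) (Fin d) ℝ) (ε : ℝ) : Prop :=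
  ∀ c' : LinearClassifier d, c.robustError μ₁ μ₂ S ε ≤ c'.robustError μ₁ μ₂ S ε

/-- The margin `‖δ_x‖` at `x`: the smallest norm of a perturbation that changes the prediction. -/
noncomputable def margin (c : LinearClassifier d) (x : EuclideanSpace ℝ (Fin d)) : ℝ :=
  sInf {r | ∃ δ : EuclideanSpace ℝ (Fin d), c.predict (x + δ) ≠ c.predict x ∧ r = ‖δ‖}

/-- The scaled margin `‖δ̄_x‖`: the margin in units of half the distance between the two class means,
measured along the normal direction of the decision boundary. -/
noncomputable def scaledMargin (c : LinearClassifier d) (μ₁ μ₂ : EuclideanSpace ℝ (Fin d))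
    (x : EuclideanSpace ℝ (Fin d)) : ℝ :=
  c.margin x / (|⟪c.weight, (2⁻¹ : ℝ) • (μ₁ - μ₂)⟫| / ‖c.weight‖)

/-- The law of a labelled sample conditioned on being classified correctly. -/
noncomputable def correctLaw (c : LinearClassifier d) (μ₁ μ₂ : EuclideanSpace ℝ (Fin d))
    (S : Matrix (Fin d) (Fin d) ℝ) : Measure (EuclideanSpace ℝ (Fin d) × ℝ) :=
  ProbabilityTheory.cond (dataLaw μ₁ μ₂ S) c.correct

/-- The expected scaled margin `E[‖δ̄_x‖ | ŷ(x) = y]` over correctly classified samples. -/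
noncomputable def expectedScaledMargin (c : LinearClassifier d)
    (μ₁ μ₂ : EuclideanSpace ℝ (Fin d)) (S : Matrix (Fin d) (Fin d) ℝ) : ℝ :=
  ∫ p, c.scaledMargin μ₁ μ₂ p.1 ∂(c.correctLaw μ₁ μ₂ S)

end LinearClassifier

/-- The quantile function `Φ⁻¹` of the standard normal distribution (the inverse of its distribution
function `Φ` on `(0, 1)`). -/
noncomputable def normalQuantile (a : ℝ) : ℝ :=
  sInf {t : ℝ | a ≤ cdf (gaussianReal 0 1) t}

/-- The reference curve `1 + φ(Φ⁻¹(a)) / (a Φ⁻¹(a))`, with `φ` the standard normal density. -/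
noncomputable def tradeoffCurve (a : ℝ) : ℝ :=
  1 + gaussianPDFReal 0 1 (normalQuantile a) / (a * normalQuantile a)

/-- `S = F Λ Fᵀ` is an economy-size eigendecomposition: the columns of `F` are orthonormal and
`Λ = diag(l)` has nonzero diagonal entries. -/
def IsThinEigendecomposition {d r : ℕ} (S : Matrix (Fin d) (Fin d) ℝ)
    (F : Matrix (Fin d) (Fin r) ℝ) (l : Fin r → ℝ) : Prop :=
  F.transpose * F = 1 ∧ F * Matrix.diagonal l * F.transpose = S ∧ ∀ i, l i ≠ 0

/-- `Fᵀ (μ₁ - μ₂) / 2`. -/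
noncomputable def reducedMean {d r : ℕ} (μ₁ μ₂ : EuclideanSpace ℝ (Fin d))
    (F : Matrix (Fin d) (Fin r) ℝ) : EuclideanSpace ℝ (Fin r) :=
  F.transpose.toEuclideanLin ((2⁻¹ : ℝ) • (μ₁ - μ₂))

/-- `z` minimizes `(m - z)ᵀ Λ⁻¹ (m - z)` over the ball `‖z‖ ≤ ε`, where `Λ = diag(l)`. -/
def IsOptimalShift {r : ℕ} (l : Fin r → ℝ) (ε : ℝ) (m z : EuclideanSpace ℝ (Fin r)) : Prop :=
  z ∈ Metric.closedBall 0 ε ∧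
    IsMinOn (fun z => ⟪m - z, (Matrix.diagonal l)⁻¹.toEuclideanLin (m - z)⟫)
      (Metric.closedBall 0 ε) z

/-- The linear classifier `x ↦ sign ((x - (μ₁ + μ₂)/2)ᵀ F Λ⁻¹ (μ̃ - z))`, where `Λ = diag(l)` and
`μ̃ = Fᵀ (μ₁ - μ₂) / 2`. -/
noncomputable def shiftedClassifier {d r : ℕ} (μ₁ μ₂ : EuclideanSpace ℝ (Fin d))
    (F : Matrix (Fin d) (Fin r) ℝ) (l : Fin r → ℝ) (z : EuclideanSpace ℝ (Fin r)) :
    LinearClassifier d where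
  weight := F.toEuclideanLin ((Matrix.diagonal l)⁻¹.toEuclideanLin (reducedMean μ₁ μ₂ F - z))
  threshold := ⟪F.toEuclideanLin
    ((Matrix.diagonal l)⁻¹.toEuclideanLin (reducedMean μ₁ μ₂ F - z)), (2⁻¹ : ℝ) • (μ₁ + μ₂)⟫

/-! Within each class the score `wᵀx - b` is Gaussian with the same standard deviation `σ =
√(wᵀSw)`. Let `A` be its mean in class `1`, `B` the negative of its mean in class `-1`, and `K = ⟨w,
(μ₁ - μ₂)/2⟩`; then `A + B = 2K` whatever the threshold. An attack of size `ε` lowers the signed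
score by at most `k = ε‖w‖`, so for `σ > 0` the robust error is `1 - (Φ((A-k)/σ) + Φ((B-k)/σ))/2`.

A pair with a fixed positive sum makes `Φ(u) + Φ(v)` largest only at `u = v`
(`cdf_gaussianReal_add_lt_of_ne`), so an optimal classifier with `σ > 0` and robust error below
`1/2` has `A = B = K > 0` (`IsRobustBayesOptimal.eq_balanced`). For every such balanced classifier
`a = Φ(K/σ)`, while the mean of the score over its positive part is `KΦ(K/σ) + σφ(K/σ)`. Dividing by
`Ka` gives the reference curve with equality (`expectedScaledMargin_balanced`). If `σ = 0`, then `a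
= 1`, which is excluded.

The explicit classifier is balanced by construction. With `v = Λ⁻¹(μ̃ - z)`, first-order optimality
of `z` reads `⟨v, z⟩ = ε‖v‖` (`IsOptimalShift.inner_eq`), so its ratio `(K - ε‖w‖)/σ` equals its own
`σ`; Cauchy–Schwarz in the `Λ`-weighted inner product bounds the ratio of every competitor by the
same number. -/

/-! ### The standard normal distribution: symmetry, concavity on the right, partial mean. -/

theorem cdf_gaussianReal_eq_integral (x : ℝ) :
    cdf (gaussianReal 0 1) x = ∫ t in Set.Iic x, gaussianPDFReal 0 1 t := by
  rw [cdf_eq_real, Measure.real, gaussianReal_apply_eq_integral 0 one_ne_zero,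
    ENNReal.toReal_ofReal (integral_nonneg fun _ => gaussianPDFReal_nonneg 0 1 _)]

theorem continuous_gaussianPDFReal : Continuous (gaussianPDFReal 0 1) := by
  unfold gaussianPDFReal
  fun_prop

theorem hasDerivAt_cdf_gaussianReal (x : ℝ) :
    HasDerivAt (cdf (gaussianReal 0 1)) (gaussianPDFReal 0 1 x) x := by
  have h : ∀ y, cdf (gaussianReal 0 1) y =
      cdf (gaussianReal 0 1) 0 + ∫ t in (0 : ℝ)..y, gaussianPDFReal 0 1 t := fun y => by
    rw [cdf_gaussianReal_eq_integral, cdf_gaussianReal_eq_integral,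
      ← intervalIntegral.integral_Iic_sub_Iic (integrable_gaussianPDFReal 0 1).integrableOn
        (integrable_gaussianPDFReal 0 1).integrableOn]
    ring
  have hd := (continuous_gaussianPDFReal.integral_hasStrictDerivAt 0 x).hasDerivAt.const_add
    (cdf (gaussianReal 0 1) 0)
  exact hd.congr_of_eventuallyEq (Filter.Eventually.of_forall h)

theorem strictMono_cdf_gaussianReal : StrictMono (cdf (gaussianReal 0 1)) :=
  strictMono_of_hasDerivAt_pos hasDerivAt_cdf_gaussianReal
    fun x => gaussianPDFReal_pos 0 1 x one_ne_zero

theorem cdf_gaussianReal_lt_one (x : ℝ) : cdf (gaussianReal 0 1) x < 1 :=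
  (strictMono_cdf_gaussianReal (lt_add_one x)).trans_le (cdf_le_one _ _)

theorem gaussianReal_real_Iio (x : ℝ) :
    (gaussianReal 0 1).real (Set.Iio x) = cdf (gaussianReal 0 1) x := by
  have := nullSingletonClass_gaussianReal (μ := 0) (v := 1) one_ne_zero
  rw [cdf_eq_real]
  exact measureReal_congr Iio_ae_eq_Iic

theorem gaussianReal_real_Ioi_neg (x : ℝ) :
    (gaussianReal 0 1).real (Set.Ioi (-x)) = cdf (gaussianReal 0 1) x := by
  have h : (gaussianReal 0 1).map (fun x => -x) = gaussianReal 0 1 := by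
    rw [gaussianReal_map_neg, neg_zero]
  rw [← gaussianReal_real_Iio, Measure.real, Measure.real]
  conv_rhs => rw [← h]
  rw [Measure.map_apply measurable_neg measurableSet_Iio]
  congr 2
  ext y
  simp

theorem cdf_gaussianReal_neg (x : ℝ) :
    cdf (gaussianReal 0 1) (-x) = 1 - cdf (gaussianReal 0 1) x := by
  rw [← gaussianReal_real_Ioi_neg (-x), neg_neg, cdf_eq_real, ← Set.compl_Iic,
    probReal_compl_eq_one_sub measurableSet_Iic]

theorem cdf_gaussianReal_zero : cdf (gaussianReal 0 1) 0 = 1 / 2 := by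
  have := cdf_gaussianReal_neg 0
  rw [neg_zero] at this
  linarith

/-- Covers the pairs outside the reach of the concavity comparison: they correspond to a robust
error of at least `1/2`. -/
theorem cdf_gaussianReal_add_le_one {u v : ℝ} (h : u + v ≤ 0) :
    cdf (gaussianReal 0 1) u + cdf (gaussianReal 0 1) v ≤ 1 := by
  have h1 := strictMono_cdf_gaussianReal.monotone (show v ≤ -u by linarith)
  rw [cdf_gaussianReal_neg] at h1
  linarith

theorem gaussianPDFReal_lt_of_abs_lt {x y : ℝ} (h : |x| < |y|) :
    gaussianPDFReal 0 1 y < gaussianPDFReal 0 1 x := by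
  unfold gaussianPDFReal
  have := sq_lt_sq.2 h
  refine mul_lt_mul_of_pos_left (Real.exp_lt_exp.2 ?_) (by positivity)
  simp only [sub_zero, NNReal.coe_one]
  linarith

/-- On the right half-line, a symmetric pair of values of the normal distribution function has a sum
that decreases strictly with the spread of the pair. -/
theorem cdf_gaussianReal_add_lt {s h : ℝ} (hs : 0 < s) (hh : 0 < h) :
    cdf (gaussianReal 0 1) (s + h) + cdf (gaussianReal 0 1) (s - h) <
      2 * cdf (gaussianReal 0 1) s := by
  have hd : ∀ t, HasDerivAt
      (fun t => cdf (gaussianReal 0 1) (s + t) + cdf (gaussianReal 0 1) (s - t))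
      (gaussianPDFReal 0 1 (s + t) - gaussianPDFReal 0 1 (s - t)) t := fun t => by
    have h1 := (hasDerivAt_cdf_gaussianReal (s + t)).comp_const_add s t
    have h2 := (hasDerivAt_cdf_gaussianReal (s - t)).comp_const_sub s t
    exact (h1.add h2).congr_deriv (by ring)
  have hanti := strictAntiOn_of_deriv_neg (convex_Ici (0 : ℝ))
    (fun t _ => (hd t).continuousAt.continuousWithinAt) fun t ht => by
      rw [interior_Ici, Set.mem_Ioi] at ht
      rw [(hd t).deriv, sub_neg]
      -- The derivative is negative because `|s - t| < |s + t|` when `s` and `t` are positive.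
      exact gaussianPDFReal_lt_of_abs_lt (sq_lt_sq.1 (by nlinarith [mul_pos hs ht]))
  have := hanti Set.self_mem_Ici (Set.mem_Ici.2 hh.le) hh
  simp only [add_zero, sub_zero] at this
  linarith

theorem cdf_gaussianReal_add_lt_of_ne {u v : ℝ} (h : 0 < u + v) (hne : u ≠ v) :
    cdf (gaussianReal 0 1) u + cdf (gaussianReal 0 1) v <
      2 * cdf (gaussianReal 0 1) ((u + v) / 2) := by
  rcases lt_or_gt_of_ne hne with h1 | h1
  · have := cdf_gaussianReal_add_lt (half_pos h) (show 0 < (v - u) / 2 by linarith)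
    rw [show (u + v) / 2 + (v - u) / 2 = v by ring, show (u + v) / 2 - (v - u) / 2 = u by ring]
      at this
    linarith
  · have := cdf_gaussianReal_add_lt (half_pos h) (show 0 < (u - v) / 2 by linarith)
    rwa [show (u + v) / 2 + (u - v) / 2 = u by ring, show (u + v) / 2 - (u - v) / 2 = v by ring]
      at this

theorem cdf_gaussianReal_add_le {u v : ℝ} (h : 0 < u + v) :
    cdf (gaussianReal 0 1) u + cdf (gaussianReal 0 1) v ≤
      2 * cdf (gaussianReal 0 1) ((u + v) / 2) := by
  rcases eq_or_ne u v with rfl | hne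
  · rw [add_self_div_two, two_mul]
  · exact (cdf_gaussianReal_add_lt_of_ne h hne).le

theorem normalQuantile_cdf (x : ℝ) : normalQuantile (cdf (gaussianReal 0 1) x) = x := by
  have : {t : ℝ | cdf (gaussianReal 0 1) x ≤ cdf (gaussianReal 0 1) t} = Set.Ici x := by
    ext t
    simp [strictMono_cdf_gaussianReal.le_iff_le]
  rw [normalQuantile, this, csInf_Ici]

theorem integrable_id_gaussianReal : Integrable (fun x : ℝ => x) (gaussianReal 0 1) :=
  (memLp_id_gaussianReal 1).integrable le_rfl

/-- Since `φ'(x) = -xφ(x)`, the function `-φ` is an antiderivative of the integrand and vanishes at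
infinity. -/
theorem setIntegral_Ioi_id_gaussianReal (a : ℝ) :
    ∫ x in Set.Ioi a, x ∂(gaussianReal 0 1) = gaussianPDFReal 0 1 a := by
  have hi := integrable_id_gaussianReal
  have hd : ∀ x, HasDerivAt (fun x => - gaussianPDFReal 0 1 x) (gaussianPDFReal 0 1 x * x) x := by
    intro x
    have h1 : HasDerivAt (fun x : ℝ => -(x - 0) ^ 2 / (2 * ((1 : NNReal) : ℝ))) (-x) x := by
      have := ((((hasDerivAt_id x).sub_const 0).pow 2).neg).div_const (2 * ((1 : NNReal) : ℝ))
      refine this.congr_deriv ?_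
      simp [neg_div]
    have h2 := ((h1.exp).const_mul (√(2 * Real.pi * ((1 : NNReal) : ℝ)))⁻¹).neg
    refine h2.congr_deriv ?_
    simp only [gaussianPDFReal]
    ring
  rw [gaussianReal_of_var_ne_zero 0 one_ne_zero] at hi ⊢
  have hint : Integrable (fun x => gaussianPDFReal 0 1 x * x) := by
    rw [integrable_withDensity_iff_integrable_smul' (measurable_gaussianPDF 0 1)
      (Filter.Eventually.of_forall fun _ => gaussianPDF_lt_top)] at hi
    simpa using hi
  rw [setIntegral_withDensity_eq_setIntegral_toReal_smul (measurable_gaussianPDF 0 1)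
      (Filter.Eventually.of_forall fun _ => gaussianPDF_lt_top) _ measurableSet_Ioi]
  simp only [toReal_gaussianPDF, smul_eq_mul]
  have ht : Filter.Tendsto (fun x => - gaussianPDFReal 0 1 x) Filter.atTop (nhds 0) :=
    tendsto_zero_of_hasDerivAt_of_integrableOn_Ioi (a := a) (fun x _ => hd x) hint.integrableOn
      (integrable_gaussianPDFReal 0 1).neg.integrableOn
  rw [integral_Ioi_of_hasDerivAt_of_tendsto' (fun x _ => hd x) hint.integrableOn ht]
  ring

/-- The partial expectation of a normal variable over the event that it is positive. -/
theorem setIntegral_pos_affine_gaussianReal (M : ℝ) {σ : ℝ} (hσ : 0 < σ) :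
    ∫ g in {g : ℝ | 0 < M + σ * g}, (M + σ * g) ∂(gaussianReal 0 1) =
      M * cdf (gaussianReal 0 1) (M / σ) + σ * gaussianPDFReal 0 1 (M / σ) := by
  have hset : {g : ℝ | 0 < M + σ * g} = Set.Ioi (-(M / σ)) := by
    ext g
    rw [Set.mem_ofPred_eq, Set.mem_Ioi, ← neg_div, div_lt_iff₀ hσ]
    constructor <;> intro h <;> linarith
  have hi := integrable_id_gaussianReal.integrableOn (s := Set.Ioi (-(M / σ)))
  rw [hset, integral_add (integrable_const _) (hi.const_mul σ), integral_const_mul,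
    setIntegral_Ioi_id_gaussianReal, setIntegral_const, gaussianReal_real_Ioi_neg, smul_eq_mul,
    mul_comm]
  simp [gaussianPDFReal]

/-! ### Reduction to one dimension and to the two classes. -/

/-- Written as an affine image of a standard normal variable, so that a degenerate score (`S` may be
singular) needs no separate statement. -/
theorem map_inner_add_multivariateGaussian {d : ℕ} {S : Matrix (Fin d) (Fin d) ℝ}
    (hS : S.PosSemidef) (μ w : EuclideanSpace ℝ (Fin d)) (b : ℝ) :
    (multivariateGaussian μ S).map (fun x => ⟪w, x⟫ + b) =
      (gaussianReal 0 1).map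
        (fun g => (⟪w, μ⟫ + b) + √(w.ofLp ⬝ᵥ S.mulVec w.ofLp) * g) := by
  have hv : Var[fun x => ⟪w, x⟫; multivariateGaussian μ S] = w.ofLp ⬝ᵥ S.mulVec w.ofLp := by
    rw [← covarianceBilin_self IsGaussian.memLp_two_id, covarianceBilin_multivariateGaussian hS]
  have hm : ∫ x, ⟪w, x⟫ ∂(multivariateGaussian μ S) = ⟪w, μ⟫ := by
    rw [integral_inner IsGaussian.integrable_fun_id, integral_id_multivariateGaussian]
  have h0 : 0 ≤ w.ofLp ⬝ᵥ S.mulVec w.ofLp := by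
    rw [← hv]
    exact variance_nonneg _ _
  have hL : (multivariateGaussian μ S).map (fun x => ⟪w, x⟫) =
      gaussianReal ⟪w, μ⟫ (w.ofLp ⬝ᵥ S.mulVec w.ofLp).toNNReal := by
    have := IsGaussian.map_eq_gaussianReal (μ := multivariateGaussian μ S) (innerSL ℝ w)
    change (multivariateGaussian μ S).map (fun x => ⟪w, x⟫) =
      gaussianReal (∫ x, ⟪w, x⟫ ∂(multivariateGaussian μ S))
        (Var[fun x => ⟪w, x⟫; multivariateGaussian μ S]).toNNReal at this
    rwa [hm, hv] at this
  have h1 := Measure.map_map (μ := multivariateGaussian μ S) (g := fun x => x + b)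
    (f := fun x => ⟪w, x⟫) (by fun_prop) (by fun_prop)
  have h2 := Measure.map_map (μ := gaussianReal 0 1) (g := fun x => (⟪w, μ⟫ + b) + x)
    (f := fun g => √(w.ofLp ⬝ᵥ S.mulVec w.ofLp) * g) (by fun_prop) (by fun_prop)
  rw [hL, gaussianReal_map_add_const] at h1
  rw [gaussianReal_map_const_mul, gaussianReal_map_const_add] at h2
  refine h1.symm.trans (Eq.trans ?_ h2)
  congr 1
  · ring
  · ext
    simp [h0]

/-- No measurability of `A` is needed, since `x ↦ (x, y)` is a measurable embedding for each label
`y`. -/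
theorem dataLaw_apply {d : ℕ} (μ₁ μ₂ : EuclideanSpace ℝ (Fin d)) (S : Matrix (Fin d) (Fin d) ℝ)
    (A : Set (EuclideanSpace ℝ (Fin d) × ℝ)) :
    (dataLaw μ₁ μ₂ S).real A =
      ((multivariateGaussian μ₁ S).real {x | (x, (1 : ℝ)) ∈ A} +
        (multivariateGaussian μ₂ S).real {x | (x, (-1 : ℝ)) ∈ A}) / 2 := by
  simp only [dataLaw, Measure.real, Measure.add_apply, Measure.smul_apply, smul_eq_mul,
    (measurableEmbedding_prod_mk_right _).map_apply]
  rw [ENNReal.toReal_add (by finiteness) (by finiteness)]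
  simp only [ENNReal.toReal_mul, ENNReal.toReal_inv, ENNReal.toReal_ofNat]
  simp only [Set.preimage]
  ring

theorem dataLaw_restrict {d : ℕ} (μ₁ μ₂ : EuclideanSpace ℝ (Fin d)) (S : Matrix (Fin d) (Fin d) ℝ)
    (A : Set (EuclideanSpace ℝ (Fin d) × ℝ)) :
    (dataLaw μ₁ μ₂ S).restrict A =
      (2⁻¹ : ℝ≥0∞) • ((multivariateGaussian μ₁ S).restrict {x | (x, (1 : ℝ)) ∈ A}).map
          (fun x => (x, (1 : ℝ))) +
        (2⁻¹ : ℝ≥0∞) • ((multivariateGaussian μ₂ S).restrict {x | (x, (-1 : ℝ)) ∈ A}).map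
          (fun x => (x, (-1 : ℝ))) := by
  rw [dataLaw, Measure.restrict_add, Measure.restrict_smul, Measure.restrict_smul,
    (measurableEmbedding_prod_mk_right _).restrict_map,
    (measurableEmbedding_prod_mk_right _).restrict_map]
  rfl

theorem integrableOn_dataLaw {d : ℕ} {μ₁ μ₂ : EuclideanSpace ℝ (Fin d)}
    {S : Matrix (Fin d) (Fin d) ℝ} {A : Set (EuclideanSpace ℝ (Fin d) × ℝ)}
    {f : EuclideanSpace ℝ (Fin d) → ℝ}
    (h₁ : IntegrableOn f {x | (x, (1 : ℝ)) ∈ A} (multivariateGaussian μ₁ S))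
    (h₂ : IntegrableOn f {x | (x, (-1 : ℝ)) ∈ A} (multivariateGaussian μ₂ S)) :
    IntegrableOn (fun p => f p.1) A (dataLaw μ₁ μ₂ S) := by
  rw [IntegrableOn, dataLaw_restrict]
  refine Integrable.add_measure (Integrable.smul_measure ?_ (by finiteness))
    (Integrable.smul_measure ?_ (by finiteness))
  · exact (measurableEmbedding_prod_mk_right _).integrable_map_iff.2 h₁
  · exact (measurableEmbedding_prod_mk_right _).integrable_map_iff.2 h₂

theorem setIntegral_dataLaw {d : ℕ} {μ₁ μ₂ : EuclideanSpace ℝ (Fin d)}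
    {S : Matrix (Fin d) (Fin d) ℝ} {A : Set (EuclideanSpace ℝ (Fin d) × ℝ)}
    {f : EuclideanSpace ℝ (Fin d) → ℝ}
    (h₁ : IntegrableOn f {x | (x, (1 : ℝ)) ∈ A} (multivariateGaussian μ₁ S))
    (h₂ : IntegrableOn f {x | (x, (-1 : ℝ)) ∈ A} (multivariateGaussian μ₂ S)) :
    ∫ p in A, f p.1 ∂(dataLaw μ₁ μ₂ S) =
      ((∫ x in {x | (x, (1 : ℝ)) ∈ A}, f x ∂(multivariateGaussian μ₁ S)) +
        ∫ x in {x | (x, (-1 : ℝ)) ∈ A}, f x ∂(multivariateGaussian μ₂ S)) / 2 := by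
  rw [dataLaw_restrict, integral_add_measure, integral_smul_measure, integral_smul_measure,
    (measurableEmbedding_prod_mk_right _).integral_map,
    (measurableEmbedding_prod_mk_right _).integral_map]
  · simp only [ENNReal.toReal_inv, ENNReal.toReal_ofNat, smul_eq_mul]
    ring
  · exact Integrable.smul_measure ((measurableEmbedding_prod_mk_right (1 : ℝ)).integrable_map_iff
      (g := fun p : EuclideanSpace ℝ (Fin d) × ℝ => f p.1).2 h₁) (by finiteness)
  · exact Integrable.smul_measure ((measurableEmbedding_prod_mk_right (-1 : ℝ)).integrable_map_iff
      (g := fun p : EuclideanSpace ℝ (Fin d) × ℝ => f p.1).2 h₂) (by finiteness)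

theorem Real.sign_eq_one_iff {t : ℝ} : Real.sign t = 1 ↔ 0 < t := by
  rcases lt_trichotomy t 0 with h | rfl | h
  · rw [Real.sign_of_neg h]
    exact ⟨fun h' => by norm_num at h', fun h' => absurd h h'.not_gt⟩
  · simp
  · simp [Real.sign_of_pos h, h]

theorem Real.sign_eq_neg_one_iff {t : ℝ} : Real.sign t = -1 ↔ t < 0 := by
  rw [← neg_pos, ← Real.sign_eq_one_iff, Real.sign_neg, neg_eq_iff_eq_neg]

/-! ### Accuracy, robust error and margin through the score. -/

namespace LinearClassifier

variable {d : ℕ}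

/-- The standard deviation of the score `wᵀ x - b` within a class. -/
noncomputable def spread (c : LinearClassifier d) (S : Matrix (Fin d) (Fin d) ℝ) : ℝ :=
  √(c.weight.ofLp ⬝ᵥ S.mulVec c.weight.ofLp)

theorem spread_nonneg (c : LinearClassifier d) (S : Matrix (Fin d) (Fin d) ℝ) : 0 ≤ c.spread S :=
  Real.sqrt_nonneg _

theorem map_score (c : LinearClassifier d) {S : Matrix (Fin d) (Fin d) ℝ}
    (hS : S.PosSemidef) (μ : EuclideanSpace ℝ (Fin d)) :
    (multivariateGaussian μ S).map (fun x => ⟪c.weight, x⟫ - c.threshold) =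
      (gaussianReal 0 1).map (fun g => (⟪c.weight, μ⟫ - c.threshold) + c.spread S * g) := by
  simpa only [sub_eq_add_neg, spread] using map_inner_add_multivariateGaussian hS μ c.weight (-c.threshold)

theorem map_neg_score (c : LinearClassifier d) {S : Matrix (Fin d) (Fin d) ℝ}
    (hS : S.PosSemidef) (μ : EuclideanSpace ℝ (Fin d)) :
    (multivariateGaussian μ S).map (fun x => c.threshold - ⟪c.weight, x⟫) =
      (gaussianReal 0 1).map (fun g => (c.threshold - ⟪c.weight, μ⟫) + c.spread S * g) := by
  have := map_inner_add_multivariateGaussian hS μ (-c.weight) c.threshold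
  simpa [spread, inner_neg_left, neg_add_eq_sub, Matrix.mulVec_neg] using this

theorem real_score_mem (c : LinearClassifier d) {S : Matrix (Fin d) (Fin d) ℝ}
    (hS : S.PosSemidef) (μ : EuclideanSpace ℝ (Fin d)) {B : Set ℝ} (hB : MeasurableSet B) :
    (multivariateGaussian μ S).real {x | ⟪c.weight, x⟫ - c.threshold ∈ B} =
      (gaussianReal 0 1).real {g | (⟪c.weight, μ⟫ - c.threshold) + c.spread S * g ∈ B} := by
  have := congrArg (fun m : Measure ℝ => m B) (c.map_score hS μ)
  rw [Measure.map_apply (by fun_prop) hB, Measure.map_apply (by fun_prop) hB] at this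
  exact congrArg ENNReal.toReal this

theorem real_neg_score_mem (c : LinearClassifier d) {S : Matrix (Fin d) (Fin d) ℝ}
    (hS : S.PosSemidef) (μ : EuclideanSpace ℝ (Fin d)) {B : Set ℝ} (hB : MeasurableSet B) :
    (multivariateGaussian μ S).real {x | c.threshold - ⟪c.weight, x⟫ ∈ B} =
      (gaussianReal 0 1).real {g | (c.threshold - ⟪c.weight, μ⟫) + c.spread S * g ∈ B} := by
  have := congrArg (fun m : Measure ℝ => m B) (c.map_neg_score hS μ)
  rw [Measure.map_apply (by fun_prop) hB, Measure.map_apply (by fun_prop) hB] at this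
  exact congrArg ENNReal.toReal this

theorem predict_eq_one_iff (c : LinearClassifier d) (x : EuclideanSpace ℝ (Fin d)) :
    c.predict x = 1 ↔ 0 < ⟪c.weight, x⟫ - c.threshold :=
  Real.sign_eq_one_iff

theorem predict_eq_neg_one_iff (c : LinearClassifier d) (x : EuclideanSpace ℝ (Fin d)) :
    c.predict x = -1 ↔ 0 < c.threshold - ⟪c.weight, x⟫ := by
  rw [predict, Real.sign_eq_neg_one_iff, sub_neg, sub_pos]

theorem mem_correct_one (c : LinearClassifier d) :
    {x | (x, (1 : ℝ)) ∈ c.correct} = {x | 0 < ⟪c.weight, x⟫ - c.threshold} := by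
  ext x
  exact c.predict_eq_one_iff x

theorem mem_correct_neg_one (c : LinearClassifier d) :
    {x | (x, (-1 : ℝ)) ∈ c.correct} = {x | 0 < c.threshold - ⟪c.weight, x⟫} := by
  ext x
  exact c.predict_eq_neg_one_iff x

theorem exists_norm_le_inner_le_iff (w x : EuclideanSpace ℝ (Fin d)) (b : ℝ) {ε : ℝ} (hε : 0 ≤ ε) :
    (∃ δ : EuclideanSpace ℝ (Fin d), ‖δ‖ ≤ ε ∧ ⟪w, x + δ⟫ - b ≤ 0) ↔ ⟪w, x⟫ - b ≤ ε * ‖w‖ := by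
  constructor
  · rintro ⟨δ, hδ, h⟩
    rw [inner_add_right] at h
    have h1 := neg_le_of_abs_le (abs_real_inner_le_norm w δ)
    have h2 := mul_le_mul_of_nonneg_left hδ (norm_nonneg w)
    linarith
  · intro h
    -- The equality case of Cauchy–Schwarz; for `w = 0` division by zero makes this `0`, which also
    -- serves.
    refine ⟨-((ε / ‖w‖) • w), ?_, ?_⟩
    · rw [norm_neg, norm_smul, Real.norm_of_nonneg (by positivity)]
      rcases eq_or_ne ‖w‖ 0 with h0 | h0
      · rwa [h0, mul_zero]
      · rw [div_mul_cancel₀ _ h0]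
    · rw [inner_add_right, inner_neg_right, inner_smul_right, real_inner_self_eq_norm_sq]
      rcases eq_or_ne ‖w‖ 0 with h0 | h0
      · rw [h0] at h ⊢
        linarith
      · rw [show ε / ‖w‖ * ‖w‖ ^ 2 = ε * ‖w‖ by field_simp]
        linarith

theorem exists_predict_ne_one_iff (c : LinearClassifier d) {ε : ℝ} (hε : 0 ≤ ε)
    (x : EuclideanSpace ℝ (Fin d)) :
    (∃ δ : EuclideanSpace ℝ (Fin d), ‖δ‖ ≤ ε ∧ c.predict (x + δ) ≠ 1) ↔
      ⟪c.weight, x⟫ - c.threshold ≤ ε * ‖c.weight‖ := by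
  simp only [Ne, predict_eq_one_iff, not_lt]
  exact exists_norm_le_inner_le_iff _ _ _ hε

theorem exists_predict_ne_neg_one_iff (c : LinearClassifier d) {ε : ℝ} (hε : 0 ≤ ε)
    (x : EuclideanSpace ℝ (Fin d)) :
    (∃ δ : EuclideanSpace ℝ (Fin d), ‖δ‖ ≤ ε ∧ c.predict (x + δ) ≠ -1) ↔
      c.threshold - ⟪c.weight, x⟫ ≤ ε * ‖c.weight‖ := by
  simp only [Ne, predict_eq_neg_one_iff, not_lt]
  have := exists_norm_le_inner_le_iff (-c.weight) x (-c.threshold) hε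
  simpa only [inner_neg_left, norm_neg, sub_neg_eq_add, neg_add_eq_sub] using this

theorem accuracy_eq (c : LinearClassifier d) (μ₁ μ₂ : EuclideanSpace ℝ (Fin d))
    {S : Matrix (Fin d) (Fin d) ℝ} (hS : S.PosSemidef) :
    c.accuracy μ₁ μ₂ S =
      ((gaussianReal 0 1).real {g | 0 < (⟪c.weight, μ₁⟫ - c.threshold) + c.spread S * g} +
        (gaussianReal 0 1).real {g | 0 < (c.threshold - ⟪c.weight, μ₂⟫) + c.spread S * g}) / 2 := by
  rw [accuracy, dataLaw_apply, mem_correct_one, mem_correct_neg_one]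
  congr 2
  · exact c.real_score_mem hS μ₁ (B := Set.Ioi 0) measurableSet_Ioi
  · exact c.real_neg_score_mem hS μ₂ (B := Set.Ioi 0) measurableSet_Ioi

theorem robustError_eq (c : LinearClassifier d) (μ₁ μ₂ : EuclideanSpace ℝ (Fin d))
    {S : Matrix (Fin d) (Fin d) ℝ} (hS : S.PosSemidef) {ε : ℝ} (hε : 0 ≤ ε) :
    c.robustError μ₁ μ₂ S ε =
      ((gaussianReal 0 1).real
          {g | (⟪c.weight, μ₁⟫ - c.threshold) + c.spread S * g ≤ ε * ‖c.weight‖} +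
        (gaussianReal 0 1).real
          {g | (c.threshold - ⟪c.weight, μ₂⟫) + c.spread S * g ≤ ε * ‖c.weight‖}) / 2 := by
  rw [robustError, dataLaw_apply]
  simp only [Set.mem_ofPred_eq, c.exists_predict_ne_one_iff hε, c.exists_predict_ne_neg_one_iff hε]
  congr 2
  · exact c.real_score_mem hS μ₁ (B := Set.Iic (ε * ‖c.weight‖)) measurableSet_Iic
  · exact c.real_neg_score_mem hS μ₂ (B := Set.Iic (ε * ‖c.weight‖)) measurableSet_Iic

theorem margin_eq (c : LinearClassifier d) (hw : c.weight ≠ 0) {x : EuclideanSpace ℝ (Fin d)}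
    (hx : ⟪c.weight, x⟫ - c.threshold ≠ 0) :
    c.margin x = |⟪c.weight, x⟫ - c.threshold| / ‖c.weight‖ := by
  have hw' : 0 < ‖c.weight‖ := norm_pos_iff.2 hw
  -- The infimum is attained at the projection onto the hyperplane: there the prediction is `0`,
  -- which already differs from the label at `x`.
  refine IsLeast.csInf_eq ⟨⟨-((⟪c.weight, x⟫ - c.threshold) / ‖c.weight‖ ^ 2) • c.weight, ?_, ?_⟩, ?_⟩
  · have : ⟪c.weight, x + -((⟪c.weight, x⟫ - c.threshold) / ‖c.weight‖ ^ 2) • c.weight⟫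
        - c.threshold = 0 := by
      rw [inner_add_right, inner_smul_right, real_inner_self_eq_norm_sq]
      field_simp
      ring
    rw [predict, this, Real.sign_zero, predict]
    exact fun h => hx (Real.sign_eq_zero_iff.1 h.symm)
  · rw [norm_smul, norm_neg, norm_div, Real.norm_eq_abs, norm_pow, norm_norm]
    field_simp
  · rintro _ ⟨δ, hδ, rfl⟩
    rw [div_le_iff₀ hw']
    by_contra! hlt
    have h1 : |⟪c.weight, δ⟫| < |⟪c.weight, x⟫ - c.threshold| := by
      refine (abs_real_inner_le_norm _ _).trans_lt ?_
      rwa [mul_comm]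
    apply hδ
    rw [predict, predict, inner_add_right]
    rcases lt_or_gt_of_ne hx with h | h
    · rw [abs_of_neg h, abs_lt] at h1
      rw [Real.sign_of_neg h, Real.sign_of_neg (by linarith)]
    · rw [abs_of_pos h, abs_lt] at h1
      rw [Real.sign_of_pos h, Real.sign_of_pos (by linarith)]

theorem scaledMargin_eq (c : LinearClassifier d) (μ₁ μ₂ : EuclideanSpace ℝ (Fin d))
    (hw : c.weight ≠ 0) {x : EuclideanSpace ℝ (Fin d)}
    (hx : ⟪c.weight, x⟫ - c.threshold ≠ 0) :
    c.scaledMargin μ₁ μ₂ x =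
      |⟪c.weight, x⟫ - c.threshold| / |⟪c.weight, (2⁻¹ : ℝ) • (μ₁ - μ₂)⟫| := by
  rw [scaledMargin, c.margin_eq hw hx, div_div_div_cancel_right₀ (norm_ne_zero_iff.2 hw)]

theorem integrable_score (c : LinearClassifier d) (μ : EuclideanSpace ℝ (Fin d))
    (S : Matrix (Fin d) (Fin d) ℝ) :
    Integrable (fun x => ⟪c.weight, x⟫ - c.threshold) (multivariateGaussian μ S) :=
  (IsGaussian.integrable_fun_id.const_inner c.weight).sub (integrable_const _)

end LinearClassifier

theorem gaussianReal_real_affine_le (M k : ℝ) {σ : ℝ} (hσ : 0 < σ) :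
    (gaussianReal 0 1).real {g | M + σ * g ≤ k} = 1 - cdf (gaussianReal 0 1) ((M - k) / σ) := by
  rw [← cdf_gaussianReal_neg, cdf_eq_real]
  congr 1
  ext g
  rw [Set.mem_ofPred_eq, Set.mem_Iic, ← neg_div, le_div_iff₀ hσ]
  constructor <;> intro h <;> linarith

theorem gaussianReal_real_affine_pos (M : ℝ) {σ : ℝ} (hσ : 0 < σ) :
    (gaussianReal 0 1).real {g | 0 < M + σ * g} = cdf (gaussianReal 0 1) (M / σ) := by
  rw [← gaussianReal_real_Ioi_neg]
  congr 1
  ext g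
  rw [Set.mem_ofPred_eq, Set.mem_Ioi, ← neg_div, div_lt_iff₀ hσ]
  constructor <;> intro h <;> linarith

theorem gaussianReal_real_affine_pos_eq_one_sub (M σ : ℝ) :
    (gaussianReal 0 1).real {g | 0 < M + σ * g} =
      1 - (gaussianReal 0 1).real {g | M + σ * g ≤ 0} := by
  rw [← probReal_compl_eq_one_sub (measurableSet_le (by fun_prop) measurable_const)]
  congr 1
  ext g
  simp

theorem gaussianReal_real_affine_le_lt_half {M k σ : ℝ} (hσ : 0 ≤ σ) (h : k < M) :
    (gaussianReal 0 1).real {g | M + σ * g ≤ k} < 1 / 2 := by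
  rcases hσ.eq_or_lt with rfl | hσ
  · simp [h.not_ge]
  · rw [gaussianReal_real_affine_le M k hσ]
    have := strictMono_cdf_gaussianReal (div_pos (sub_pos.2 h) hσ)
    rw [cdf_gaussianReal_zero] at this
    linarith

/-! ### Balanced classifiers and the necessary conditions for optimality. -/

namespace LinearClassifier

variable {d : ℕ} {μ₁ μ₂ : EuclideanSpace ℝ (Fin d)} {S : Matrix (Fin d) (Fin d) ℝ}

theorem one_sub_robustError_le_accuracy (c : LinearClassifier d) (hS : S.PosSemidef) {ε : ℝ}
    (hε : 0 ≤ ε) : 1 - c.robustError μ₁ μ₂ S ε ≤ c.accuracy μ₁ μ₂ S := by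
  rw [c.robustError_eq μ₁ μ₂ hS hε, c.accuracy_eq μ₁ μ₂ hS,
    gaussianReal_real_affine_pos_eq_one_sub, gaussianReal_real_affine_pos_eq_one_sub]
  have h : ∀ M : ℝ, (gaussianReal 0 1).real {g | M + c.spread S * g ≤ 0} ≤
      (gaussianReal 0 1).real {g | M + c.spread S * g ≤ ε * ‖c.weight‖} := fun M =>
    measureReal_mono fun g hg => by
      rw [Set.mem_ofPred_eq] at hg ⊢
      exact hg.trans (by positivity)
  have h1 := h (⟪c.weight, μ₁⟫ - c.threshold)
  have h2 := h (c.threshold - ⟪c.weight, μ₂⟫)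
  linarith

/-- The classifier with weight `w` whose decision boundary contains the midpoint of the means. -/
noncomputable def balanced (μ₁ μ₂ w : EuclideanSpace ℝ (Fin d)) : LinearClassifier d :=
  ⟨w, ⟪w, (2⁻¹ : ℝ) • (μ₁ + μ₂)⟫⟩

theorem balanced_score_left (μ₁ μ₂ w : EuclideanSpace ℝ (Fin d)) :
    ⟪w, μ₁⟫ - ⟪w, (2⁻¹ : ℝ) • (μ₁ + μ₂)⟫ = ⟪w, (2⁻¹ : ℝ) • (μ₁ - μ₂)⟫ := by
  simp only [inner_smul_right, inner_add_right, inner_sub_right]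
  ring

theorem balanced_score_right (μ₁ μ₂ w : EuclideanSpace ℝ (Fin d)) :
    ⟪w, (2⁻¹ : ℝ) • (μ₁ + μ₂)⟫ - ⟪w, μ₂⟫ = ⟪w, (2⁻¹ : ℝ) • (μ₁ - μ₂)⟫ := by
  simp only [inner_smul_right, inner_add_right, inner_sub_right]
  ring

theorem robustError_balanced (hS : S.PosSemidef) {ε : ℝ} (hε : 0 ≤ ε)
    (w : EuclideanSpace ℝ (Fin d)) :
    (balanced μ₁ μ₂ w).robustError μ₁ μ₂ S ε =
      (gaussianReal 0 1).real {g | ⟪w, (2⁻¹ : ℝ) • (μ₁ - μ₂)⟫ +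
        (balanced μ₁ μ₂ w).spread S * g ≤ ε * ‖w‖} := by
  rw [robustError_eq _ μ₁ μ₂ hS hε]
  simp only [balanced, balanced_score_left, balanced_score_right]
  ring

theorem accuracy_balanced (hS : S.PosSemidef) {w : EuclideanSpace ℝ (Fin d)}
    (hσ : 0 < (balanced μ₁ μ₂ w).spread S) :
    (balanced μ₁ μ₂ w).accuracy μ₁ μ₂ S =
      cdf (gaussianReal 0 1)
        (⟪w, (2⁻¹ : ℝ) • (μ₁ - μ₂)⟫ / (balanced μ₁ μ₂ w).spread S) := by
  rw [accuracy_eq _ μ₁ μ₂ hS, gaussianReal_real_affine_pos _ hσ, gaussianReal_real_affine_pos _ hσ]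
  simp only [balanced, balanced_score_left, balanced_score_right]
  ring

theorem measurableSet_score_pos (c : LinearClassifier d) :
    MeasurableSet {x | 0 < ⟪c.weight, x⟫ - c.threshold} :=
  measurableSet_lt measurable_const (by fun_prop)

theorem measurableSet_neg_score_pos (c : LinearClassifier d) :
    MeasurableSet {x | 0 < c.threshold - ⟪c.weight, x⟫} :=
  measurableSet_lt measurable_const (by fun_prop)

theorem scaledMargin_eqOn_score_pos (c : LinearClassifier d) (hw : c.weight ≠ 0) :
    Set.EqOn (c.scaledMargin μ₁ μ₂)
      (fun x => (⟪c.weight, x⟫ - c.threshold) / |⟪c.weight, (2⁻¹ : ℝ) • (μ₁ - μ₂)⟫|)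
      {x | 0 < ⟪c.weight, x⟫ - c.threshold} := fun x hx => by
  rw [Set.mem_ofPred_eq] at hx
  rw [c.scaledMargin_eq μ₁ μ₂ hw hx.ne', abs_of_pos hx]

theorem scaledMargin_eqOn_neg_score_pos (c : LinearClassifier d) (hw : c.weight ≠ 0) :
    Set.EqOn (c.scaledMargin μ₁ μ₂)
      (fun x => (c.threshold - ⟪c.weight, x⟫) / |⟪c.weight, (2⁻¹ : ℝ) • (μ₁ - μ₂)⟫|)
      {x | 0 < c.threshold - ⟪c.weight, x⟫} := fun x hx => by
  rw [Set.mem_ofPred_eq] at hx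
  have hx' : ⟪c.weight, x⟫ - c.threshold < 0 := by linarith
  rw [c.scaledMargin_eq μ₁ μ₂ hw hx'.ne, abs_of_neg hx', neg_sub]

theorem integrableOn_scaledMargin_score_pos (c : LinearClassifier d) (hw : c.weight ≠ 0)
    (μ : EuclideanSpace ℝ (Fin d)) :
    IntegrableOn (c.scaledMargin μ₁ μ₂) {x | (x, (1 : ℝ)) ∈ c.correct}
      (multivariateGaussian μ S) := by
  rw [mem_correct_one]
  exact (((c.integrable_score μ S).div_const _).integrableOn).congr_fun
    (c.scaledMargin_eqOn_score_pos hw).symm c.measurableSet_score_pos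

theorem integrableOn_scaledMargin_neg_score_pos (c : LinearClassifier d) (hw : c.weight ≠ 0)
    (μ : EuclideanSpace ℝ (Fin d)) :
    IntegrableOn (c.scaledMargin μ₁ μ₂) {x | (x, (-1 : ℝ)) ∈ c.correct}
      (multivariateGaussian μ S) := by
  rw [mem_correct_neg_one]
  have h := (c.integrable_score μ S).neg.congr
    (Filter.Eventually.of_forall fun x => neg_sub ⟪c.weight, x⟫ c.threshold)
  exact ((h.div_const _).integrableOn).congr_fun
    (c.scaledMargin_eqOn_neg_score_pos hw).symm c.measurableSet_neg_score_pos

theorem integrable_scaledMargin_correctLaw (c : LinearClassifier d) (hw : c.weight ≠ 0)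
    (ha : 0 < c.accuracy μ₁ μ₂ S) :
    Integrable (fun p => c.scaledMargin μ₁ μ₂ p.1) (c.correctLaw μ₁ μ₂ S) := by
  have h0 : dataLaw μ₁ μ₂ S c.correct ≠ 0 := fun h => by
    simp [accuracy, Measure.real, h] at ha
  exact Integrable.smul_measure (integrableOn_dataLaw (c.integrableOn_scaledMargin_score_pos hw μ₁)
    (c.integrableOn_scaledMargin_neg_score_pos hw μ₂)) (ENNReal.inv_ne_top.2 h0)

theorem setIntegral_score_pos (c : LinearClassifier d) (hS : S.PosSemidef)
    (μ : EuclideanSpace ℝ (Fin d)) :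
    ∫ x in {x | 0 < ⟪c.weight, x⟫ - c.threshold},
        (⟪c.weight, x⟫ - c.threshold) ∂(multivariateGaussian μ S) =
      ∫ g in {g | 0 < (⟪c.weight, μ⟫ - c.threshold) + c.spread S * g},
        ((⟪c.weight, μ⟫ - c.threshold) + c.spread S * g) ∂(gaussianReal 0 1) := by
  have h1 := setIntegral_map (μ := multivariateGaussian μ S) (s := Set.Ioi 0) (f := fun t : ℝ => t)
    (g := fun x => ⟪c.weight, x⟫ - c.threshold) measurableSet_Ioi (by fun_prop) (by fun_prop)
  have h2 := setIntegral_map (μ := gaussianReal 0 1) (s := Set.Ioi 0) (f := fun t : ℝ => t)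
    (g := fun g => (⟪c.weight, μ⟫ - c.threshold) + c.spread S * g)
    measurableSet_Ioi (by fun_prop) (by fun_prop)
  rw [c.map_score hS μ] at h1
  exact h1.symm.trans h2

theorem setIntegral_neg_score_pos (c : LinearClassifier d) (hS : S.PosSemidef)
    (μ : EuclideanSpace ℝ (Fin d)) :
    ∫ x in {x | 0 < c.threshold - ⟪c.weight, x⟫},
        (c.threshold - ⟪c.weight, x⟫) ∂(multivariateGaussian μ S) =
      ∫ g in {g | 0 < (c.threshold - ⟪c.weight, μ⟫) + c.spread S * g},
        ((c.threshold - ⟪c.weight, μ⟫) + c.spread S * g) ∂(gaussianReal 0 1) := by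
  have h1 := setIntegral_map (μ := multivariateGaussian μ S) (s := Set.Ioi 0) (f := fun t : ℝ => t)
    (g := fun x => c.threshold - ⟪c.weight, x⟫) measurableSet_Ioi (by fun_prop) (by fun_prop)
  have h2 := setIntegral_map (μ := gaussianReal 0 1) (s := Set.Ioi 0) (f := fun t : ℝ => t)
    (g := fun g => (c.threshold - ⟪c.weight, μ⟫) + c.spread S * g)
    measurableSet_Ioi (by fun_prop) (by fun_prop)
  rw [c.map_neg_score hS μ] at h1
  exact h1.symm.trans h2

/-- A balanced linear classifier that points from `μ₂` to `μ₁` lies exactly on the reference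
curve. -/
theorem expectedScaledMargin_balanced (hS : S.PosSemidef) {w : EuclideanSpace ℝ (Fin d)}
    (hσ : 0 < (balanced μ₁ μ₂ w).spread S) (hK : 0 < ⟪w, (2⁻¹ : ℝ) • (μ₁ - μ₂)⟫) :
    (balanced μ₁ μ₂ w).expectedScaledMargin μ₁ μ₂ S =
      tradeoffCurve ((balanced μ₁ μ₂ w).accuracy μ₁ μ₂ S) := by
  set c := balanced μ₁ μ₂ w with hc
  have hw : c.weight ≠ 0 := fun h => by
    rw [show w = 0 from h, inner_zero_left] at hK
    exact hK.false
  have ha := accuracy_balanced hS hσ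
  rw [← hc] at ha
  have hapos : 0 < cdf (gaussianReal 0 1) (⟪w, (2⁻¹ : ℝ) • (μ₁ - μ₂)⟫ / c.spread S) := by
    have := strictMono_cdf_gaussianReal (div_pos hK hσ)
    rw [cdf_gaussianReal_zero] at this
    linarith
  have hmargin := setIntegral_dataLaw (f := c.scaledMargin μ₁ μ₂)
    (c.integrableOn_scaledMargin_score_pos (S := S) hw μ₁)
    (c.integrableOn_scaledMargin_neg_score_pos (S := S) hw μ₂)
  rw [mem_correct_one, mem_correct_neg_one,
    setIntegral_congr_fun c.measurableSet_score_pos (c.scaledMargin_eqOn_score_pos hw),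
    setIntegral_congr_fun c.measurableSet_neg_score_pos (c.scaledMargin_eqOn_neg_score_pos hw),
    integral_div, integral_div, c.setIntegral_score_pos hS, c.setIntegral_neg_score_pos hS,
    setIntegral_pos_affine_gaussianReal _ hσ, setIntegral_pos_affine_gaussianReal _ hσ] at hmargin
  have h1 : ⟪c.weight, μ₁⟫ - c.threshold = ⟪w, (2⁻¹ : ℝ) • (μ₁ - μ₂)⟫ := balanced_score_left _ _ _
  have h2 : c.threshold - ⟪c.weight, μ₂⟫ = ⟪w, (2⁻¹ : ℝ) • (μ₁ - μ₂)⟫ := balanced_score_right _ _ _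
  have h3 : ⟪c.weight, (2⁻¹ : ℝ) • (μ₁ - μ₂)⟫ = ⟪w, (2⁻¹ : ℝ) • (μ₁ - μ₂)⟫ := rfl
  rw [h1, h2, h3, abs_of_pos hK, add_self_div_two] at hmargin
  rw [expectedScaledMargin, correctLaw, ProbabilityTheory.cond, integral_smul_measure, hmargin,
    ENNReal.toReal_inv]
  change (c.accuracy μ₁ μ₂ S)⁻¹ • _ = _
  rw [ha, tradeoffCurve, normalQuantile_cdf, smul_eq_mul]
  -- What remains is `(KΦ + σφ)/(KΦ) = 1 + φ/(Φ · K/σ)`, with `Φ` and `φ` taken at `K/σ`.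
  generalize ⟪w, (2⁻¹ : ℝ) • (μ₁ - μ₂)⟫ = K at hK hapos ⊢
  field_simp

/-- The weight `w = (μ₁ - μ₂)/2` works, because `K - ε‖w‖ = ‖w‖(‖w‖ - ε)` is positive. -/
theorem exists_robustError_lt_half (hS : S.PosSemidef) {ε : ℝ} (hε : 0 ≤ ε)
    (h : ε < ‖(2⁻¹ : ℝ) • (μ₁ - μ₂)‖) :
    ∃ c : LinearClassifier d, c.robustError μ₁ μ₂ S ε < 1 / 2 := by
  refine ⟨balanced μ₁ μ₂ ((2⁻¹ : ℝ) • (μ₁ - μ₂)), ?_⟩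
  rw [robustError_balanced hS hε]
  refine gaussianReal_real_affine_le_lt_half (spread_nonneg _ _) ?_
  rw [real_inner_self_eq_norm_sq, sq]
  exact mul_lt_mul_of_pos_right h (hε.trans_lt h)

/-- A zero weight gives a constant prediction, which is wrong on at least one whole class. -/
theorem weight_ne_zero_of_robustError_lt_half (c : LinearClassifier d) (hS : S.PosSemidef) {ε : ℝ}
    (hε : 0 ≤ ε) (h : c.robustError μ₁ μ₂ S ε < 1 / 2) : c.weight ≠ 0 := fun hw => by
  rw [c.robustError_eq μ₁ μ₂ hS hε] at h
  have hσ : c.spread S = 0 := by simp [spread, hw]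
  simp only [hw, hσ, inner_zero_left, norm_zero, mul_zero, zero_mul, add_zero, zero_sub,
    sub_zero] at h
  rcases le_total 0 c.threshold with h0 | h0 <;> simp [h0] at h
  · linarith [measureReal_nonneg (μ := gaussianReal 0 1) (s := {g | c.threshold ≤ 0})]
  · linarith [measureReal_nonneg (μ := gaussianReal 0 1) (s := {g | 0 ≤ c.threshold})]

/-- With a constant score in each class the robust error is `0`, `1/2` or `1`; below `1/2` it is
`0`. -/
theorem accuracy_eq_one_of_spread_eq_zero (c : LinearClassifier d) (hS : S.PosSemidef) {ε : ℝ}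
    (hε : 0 ≤ ε) (h : c.robustError μ₁ μ₂ S ε < 1 / 2) (hσ : c.spread S = 0) :
    c.accuracy μ₁ μ₂ S = 1 := by
  rw [c.robustError_eq μ₁ μ₂ hS hε, hσ] at h
  rw [c.accuracy_eq μ₁ μ₂ hS, hσ]
  have hk : 0 ≤ ε * ‖c.weight‖ := by positivity
  have key : ∀ A B : ℝ, ((gaussianReal 0 1).real {g | A + 0 * g ≤ ε * ‖c.weight‖} + B) / 2 < 1 / 2 →
      0 ≤ B → (gaussianReal 0 1).real {g | 0 < A + 0 * g} = 1 := fun A B hAB hB => by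
    rcases le_or_gt A (ε * ‖c.weight‖) with hA | hA
    · simp [hA] at hAB
      linarith
    · simp [hk.trans_lt hA]
  rw [key _ _ h measureReal_nonneg, key _ _ (by rwa [add_comm] at h) measureReal_nonneg]
  norm_num

/-- A robust Bayes optimal classifier with a nondegenerate score is balanced and separates the
means by more than the budget. -/
theorem IsRobustBayesOptimal.eq_balanced {c : LinearClassifier d} (hS : S.PosSemidef) {ε : ℝ}
    (hε : 0 ≤ ε) (hc : c.IsRobustBayesOptimal μ₁ μ₂ S ε) (h : c.robustError μ₁ μ₂ S ε < 1 / 2)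
    (hσ : 0 < c.spread S) :
    c = balanced μ₁ μ₂ c.weight ∧ 0 < ⟪c.weight, (2⁻¹ : ℝ) • (μ₁ - μ₂)⟫ := by
  have hsum : (⟪c.weight, μ₁⟫ - c.threshold) + (c.threshold - ⟪c.weight, μ₂⟫) =
      2 * ⟪c.weight, (2⁻¹ : ℝ) • (μ₁ - μ₂)⟫ := by
    rw [inner_smul_right, inner_sub_right]
    ring
  have hopt := hc (balanced μ₁ μ₂ c.weight)
  rw [robustError_balanced hS hε, show (balanced μ₁ μ₂ c.weight).spread S = c.spread S from rfl,
    gaussianReal_real_affine_le _ _ hσ] at hopt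
  rw [c.robustError_eq μ₁ μ₂ hS hε, gaussianReal_real_affine_le _ _ hσ,
    gaussianReal_real_affine_le _ _ hσ] at h hopt
  set A := ⟪c.weight, μ₁⟫ - c.threshold
  set B := c.threshold - ⟪c.weight, μ₂⟫ with hB
  set k := ε * ‖c.weight‖
  have hmean : ((A - k) / c.spread S + (B - k) / c.spread S) / 2 =
      (⟪c.weight, (2⁻¹ : ℝ) • (μ₁ - μ₂)⟫ - k) / c.spread S := by
    field_simp
    linarith
  have hpos : 0 < (A - k) / c.spread S + (B - k) / c.spread S := by
    by_contra! hle
    linarith [cdf_gaussianReal_add_le_one hle]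
  -- Otherwise moving the threshold to the midpoint, with the same weight, would strictly lower the
  -- robust error.
  have heq : (A - k) / c.spread S = (B - k) / c.spread S := by
    by_contra hne
    have := cdf_gaussianReal_add_lt_of_ne hpos hne
    rw [hmean] at this
    change 1 - cdf (gaussianReal 0 1)
      ((⟪c.weight, (2⁻¹ : ℝ) • (μ₁ - μ₂)⟫ - k) / c.spread S) ≥ _ at hopt
    linarith
  have hAB : A = B := by
    rw [div_left_inj' hσ.ne'] at heq
    linarith
  have hk : 0 ≤ k := by positivity
  refine ⟨?_, ?_⟩
  · have : c.threshold = ⟪c.weight, (2⁻¹ : ℝ) • (μ₁ + μ₂)⟫ := by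
      have := balanced_score_right μ₁ μ₂ c.weight
      linarith
    rw [balanced, ← this]
  · rw [← add_div, div_pos_iff_of_pos_right hσ] at hpos
    linarith

end LinearClassifier

/-! ### A lower bound valid for every linear classifier. -/

namespace LinearClassifier

variable {d : ℕ} {μ₁ μ₂ : EuclideanSpace ℝ (Fin d)} {S : Matrix (Fin d) (Fin d) ℝ}

/-- A lower bound on the robust error of a linear classifier in terms of a bound on its
signal-to-noise ratio. -/
theorem one_sub_cdf_le_robustError (c : LinearClassifier d) (hS : S.PosSemidef) {ε : ℝ}
    (hε : 0 ≤ ε) {ρ : ℝ} (hρ : 0 ≤ ρ)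
    (h : ⟪c.weight, (2⁻¹ : ℝ) • (μ₁ - μ₂)⟫ - ε * ‖c.weight‖ ≤ c.spread S * ρ) :
    1 - cdf (gaussianReal 0 1) ρ ≤ c.robustError μ₁ μ₂ S ε := by
  have hsum : (⟪c.weight, μ₁⟫ - c.threshold) + (c.threshold - ⟪c.weight, μ₂⟫) =
      2 * ⟪c.weight, (2⁻¹ : ℝ) • (μ₁ - μ₂)⟫ := by
    rw [inner_smul_right, inner_sub_right]
    ring
  have hhalf : 1 / 2 ≤ cdf (gaussianReal 0 1) ρ := by
    rw [← cdf_gaussianReal_zero]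
    exact monotone_cdf _ hρ
  rw [c.robustError_eq μ₁ μ₂ hS hε]
  set A := ⟪c.weight, μ₁⟫ - c.threshold
  set B := c.threshold - ⟪c.weight, μ₂⟫
  set k := ε * ‖c.weight‖
  -- If the spread is zero, `h` gives `(A + B)/2 ≤ k`, so one class is lost entirely and the error
  -- is at least `1/2`.
  rcases (c.spread_nonneg S).eq_or_lt with hσ | hσ
  · rw [← hσ] at h ⊢
    have hA := measureReal_nonneg (μ := gaussianReal 0 1) (s := {g | A + 0 * g ≤ k})
    have hB := measureReal_nonneg (μ := gaussianReal 0 1) (s := {g | B + 0 * g ≤ k})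
    rcases le_or_gt A k with hAk | hAk
    · have : (gaussianReal 0 1).real {g | A + 0 * g ≤ k} = 1 := by simp [hAk]
      linarith
    · have hBk : B ≤ k := by linarith
      have : (gaussianReal 0 1).real {g | B + 0 * g ≤ k} = 1 := by simp [hBk]
      linarith
  · rw [gaussianReal_real_affine_le _ _ hσ, gaussianReal_real_affine_le _ _ hσ]
    have hmean : ((A - k) / c.spread S + (B - k) / c.spread S) / 2 ≤ ρ := by
      rw [← add_div, div_div, div_le_iff₀ (by positivity)]
      linarith
    rcases le_or_gt ((A - k) / c.spread S + (B - k) / c.spread S) 0 with h0 | h0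
    · linarith [cdf_gaussianReal_add_le_one h0]
    · linarith [cdf_gaussianReal_add_le h0, monotone_cdf (gaussianReal 0 1) hmean]

end LinearClassifier

/-! ### Linear algebra of the economy-size eigendecomposition. -/

theorem Matrix.inner_toEuclideanLin_left {m n : ℕ} (A : Matrix (Fin m) (Fin n) ℝ)
    (x : EuclideanSpace ℝ (Fin n)) (y : EuclideanSpace ℝ (Fin m)) :
    ⟪A.toEuclideanLin x, y⟫ = ⟪x, A.transpose.toEuclideanLin y⟫ := by
  rw [← Matrix.conjTranspose_eq_transpose_of_trivial, Matrix.toEuclideanLin_conjTranspose_eq_adjoint,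
    LinearMap.adjoint_inner_right]

theorem Matrix.toEuclideanLin_mul_apply {k m n : ℕ} (A : Matrix (Fin k) (Fin m) ℝ)
    (B : Matrix (Fin m) (Fin n) ℝ) (x : EuclideanSpace ℝ (Fin n)) :
    (A * B).toEuclideanLin x = A.toEuclideanLin (B.toEuclideanLin x) := by
  simp [Matrix.toLpLin_apply]

theorem Matrix.diagonal_toEuclideanLin_apply {r : ℕ} (l : Fin r → ℝ) (x : EuclideanSpace ℝ (Fin r))
    (i : Fin r) : (Matrix.diagonal l).toEuclideanLin x i = l i * x i := by
  simp [Matrix.toLpLin_apply, Matrix.mulVec_diagonal]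

theorem Matrix.inv_diagonal_of_ne_zero {r : ℕ} {l : Fin r → ℝ} (hl : ∀ i, l i ≠ 0) :
    (Matrix.diagonal l)⁻¹ = Matrix.diagonal fun i => (l i)⁻¹ := by
  refine Matrix.inv_eq_right_inv ?_
  rw [Matrix.diagonal_mul_diagonal, ← Matrix.diagonal_one]
  congr 1
  ext i
  exact mul_inv_cancel₀ (hl i)

/-- Cauchy–Schwarz for `Λ^{1/2} v` and `Λ^{-1/2} p`. -/
theorem Matrix.inner_le_sqrt_mul_sqrt_inv_diagonal {r : ℕ} {l : Fin r → ℝ} (hl : ∀ i, 0 < l i)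
    (v p : EuclideanSpace ℝ (Fin r)) :
    ⟪v, p⟫ ≤ √⟪v, (Matrix.diagonal l).toEuclideanLin v⟫ *
      √⟪p, (Matrix.diagonal l)⁻¹.toEuclideanLin p⟫ := by
  have h := Real.sum_mul_le_sqrt_mul_sqrt Finset.univ (fun i => √(l i) * v i)
    (fun i => (√(l i))⁻¹ * p i)
  rw [Matrix.inv_diagonal_of_ne_zero fun i => (hl i).ne']
  simp only [PiLp.inner_apply, Matrix.diagonal_toEuclideanLin_apply, RCLike.inner_apply, conj_trivial]
  refine (Finset.sum_congr rfl fun i _ => ?_).trans_le (h.trans_eq ?_)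
  · have : √(l i) ≠ 0 := (Real.sqrt_pos.2 (hl i)).ne'
    field_simp
  · congr 2 <;> refine Finset.sum_congr rfl fun i _ => ?_
    · rw [mul_pow, Real.sq_sqrt (hl i).le]
      ring
    · rw [mul_pow, inv_pow, Real.sq_sqrt (hl i).le]
      ring

theorem Matrix.inner_inv_diagonal_pos {r : ℕ} {l : Fin r → ℝ} (hl : ∀ i, 0 < l i)
    {p : EuclideanSpace ℝ (Fin r)} (hp : p ≠ 0) :
    0 < ⟪p, (Matrix.diagonal l)⁻¹.toEuclideanLin p⟫ := by
  have h := Matrix.inner_le_sqrt_mul_sqrt_inv_diagonal hl p p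
  rw [← Real.sqrt_pos]
  refine (Real.sqrt_nonneg _).lt_of_ne fun h0 => ?_
  rw [← h0, mul_zero] at h
  exact h.not_gt (real_inner_self_pos.2 hp)

theorem Matrix.inner_inv_diagonal_comm {r : ℕ} {l : Fin r → ℝ} (hl : ∀ i, l i ≠ 0)
    (p q : EuclideanSpace ℝ (Fin r)) :
    ⟪p, (Matrix.diagonal l)⁻¹.toEuclideanLin q⟫ = ⟪q, (Matrix.diagonal l)⁻¹.toEuclideanLin p⟫ := by
  rw [real_inner_comm, Matrix.inner_toEuclideanLin_left, Matrix.inv_diagonal_of_ne_zero hl,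
    Matrix.diagonal_transpose]

namespace IsThinEigendecomposition

variable {d r : ℕ} {S : Matrix (Fin d) (Fin d) ℝ} {F : Matrix (Fin d) (Fin r) ℝ} {l : Fin r → ℝ}

/-- `FᵀSF = Λ` inherits positive semidefiniteness from `S`, and its diagonal entries are nonzero. -/
theorem eigenvalue_pos (h : IsThinEigendecomposition S F l) (hS : S.PosSemidef) (i : Fin r) :
    0 < l i := by
  have h1 := hS.conjTranspose_mul_mul_same F
  rw [Matrix.conjTranspose_eq_transpose_of_trivial, ← h.2.1,
    show F.transpose * (F * Matrix.diagonal l * F.transpose) * F =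
      (F.transpose * F) * Matrix.diagonal l * (F.transpose * F) by simp only [Matrix.mul_assoc],
    h.1, Matrix.one_mul, Matrix.mul_one, Matrix.posSemidef_diagonal_iff] at h1
  exact (h1 i).lt_of_ne (h.2.2 i).symm

theorem transpose_apply_apply (h : IsThinEigendecomposition S F l)
    (x : EuclideanSpace ℝ (Fin r)) : F.transpose.toEuclideanLin (F.toEuclideanLin x) = x := by
  rw [← Matrix.toEuclideanLin_mul_apply, h.1]
  simp

theorem norm_apply (h : IsThinEigendecomposition S F l) (x : EuclideanSpace ℝ (Fin r)) :
    ‖F.toEuclideanLin x‖ = ‖x‖ := by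
  rw [@norm_eq_sqrt_real_inner, @norm_eq_sqrt_real_inner, Matrix.inner_toEuclideanLin_left,
    h.transpose_apply_apply]

theorem norm_transpose_apply_le (h : IsThinEigendecomposition S F l)
    (x : EuclideanSpace ℝ (Fin d)) : ‖F.transpose.toEuclideanLin x‖ ≤ ‖x‖ := by
  set y := F.transpose.toEuclideanLin x with hy
  have h1 : ‖y‖ * ‖y‖ ≤ ‖x‖ * ‖y‖ := by
    rw [← real_inner_self_eq_norm_mul_norm]
    nth_rw 2 [hy]
    rw [← Matrix.inner_toEuclideanLin_left, real_inner_comm]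
    exact (real_inner_le_norm _ _).trans_eq (by rw [h.norm_apply])
  rcases (norm_nonneg y).eq_or_lt with h0 | h0
  · rw [← h0]
    exact norm_nonneg _
  · exact le_of_mul_le_mul_right h1 h0

theorem spread_eq (h : IsThinEigendecomposition S F l) (c : LinearClassifier d) :
    c.spread S = √⟪F.transpose.toEuclideanLin c.weight,
      (Matrix.diagonal l).toEuclideanLin (F.transpose.toEuclideanLin c.weight)⟫ := by
  rw [Matrix.inner_toEuclideanLin_left, Matrix.transpose_transpose,
    ← Matrix.toEuclideanLin_mul_apply, ← Matrix.toEuclideanLin_mul_apply,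
    h.2.1, LinearClassifier.spread]
  congr 1
  rw [EuclideanSpace.inner_eq_star_dotProduct, dotProduct_comm]
  rfl

/-- `FFᵀ` fixes the range of `S`. The range condition serves to lose nothing of the mean difference
when passing to `μ̃`. -/
theorem apply_reducedMean (h : IsThinEigendecomposition S F l) {μ₁ μ₂ : EuclideanSpace ℝ (Fin d)}
    (hμ : μ₁ - μ₂ ∈ LinearMap.range S.toEuclideanLin) :
    F.toEuclideanLin (reducedMean μ₁ μ₂ F) = (2⁻¹ : ℝ) • (μ₁ - μ₂) := by
  obtain ⟨u, hu⟩ := hμ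
  rw [reducedMean, ← hu, ← h.2.1, Matrix.mul_assoc, Matrix.toEuclideanLin_mul_apply, map_smul,
    h.transpose_apply_apply, map_smul]

end IsThinEigendecomposition

/-- The first-order optimality condition for the shift: `z` is the point of the ball that is extremal
in the direction `Λ⁻¹ (m - z)`. -/
theorem IsOptimalShift.inner_eq {r : ℕ} {l : Fin r → ℝ} (hl : ∀ i, l i ≠ 0) {ε : ℝ} (hε : 0 ≤ ε)
    {m z : EuclideanSpace ℝ (Fin r)} (h : IsOptimalShift l ε m z) :
    ⟪(Matrix.diagonal l)⁻¹.toEuclideanLin (m - z), z⟫ =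
      ε * ‖(Matrix.diagonal l)⁻¹.toEuclideanLin (m - z)‖ := by
  set v := (Matrix.diagonal l)⁻¹.toEuclideanLin (m - z) with hv
  have hz : ‖z‖ ≤ ε := mem_closedBall_zero_iff.1 h.1
  refine le_antisymm ?_ ?_
  · rw [mul_comm]
    exact (real_inner_le_norm _ _).trans (mul_le_mul_of_nonneg_left hz (norm_nonneg _))
  · have key : ∀ y ∈ Metric.closedBall (0 : EuclideanSpace ℝ (Fin r)) ε, ⟪y - z, v⟫ ≤ 0 := by
      intro y hy
      set q := y - z with hq
      set Q := ⟪q, (Matrix.diagonal l)⁻¹.toEuclideanLin q⟫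
      -- Compare `z` with the point `z + t(y - z)` of the ball and divide by `t`.
      have hstep : ∀ t : ℝ, 0 < t → t ≤ 1 → 2 * ⟪q, v⟫ ≤ t * Q := by
        intro t ht ht1
        have hmem : z + t • q ∈ Metric.closedBall (0 : EuclideanSpace ℝ (Fin r)) ε :=
          (convex_closedBall _ _).add_smul_sub_mem h.1 hy ⟨ht.le, ht1⟩
        have hmin := isMinOn_iff.1 h.2 _ hmem
        have hexp : ⟪m - (z + t • q), (Matrix.diagonal l)⁻¹.toEuclideanLin (m - (z + t • q))⟫ =
            ⟪m - z, v⟫ - t * (2 * ⟪q, v⟫) + t * (t * Q) := by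
          have hcomm := Matrix.inner_inv_diagonal_comm hl (m - z) q
          rw [← sub_sub, map_sub, map_smul, ← hv]
          simp only [inner_sub_left, inner_sub_right, inner_smul_left, inner_smul_right,
            conj_trivial] at hcomm ⊢
          linear_combination (-t) * hcomm
        rw [hexp] at hmin
        have : t * (2 * ⟪q, v⟫) ≤ t * (t * Q) := by linarith
        exact le_of_mul_le_mul_left this ht
      by_contra! hpos
      have hQ := hstep 1 one_pos le_rfl
      have hQpos : 0 < Q := by linarith
      -- This `t` replaces `tQ` by `⟪q, v⟫`, so `2⟪q, v⟫ ≤ ⟪q, v⟫`, which contradicts positivity.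
      have := hstep (⟪q, v⟫ / Q) (by positivity) (by rw [div_le_one hQpos]; linarith)
      rw [div_mul_cancel₀ _ hQpos.ne'] at this
      linarith
    rcases eq_or_ne v 0 with h0 | h0
    · simp [h0]
    · have hn : ‖v‖ ≠ 0 := norm_ne_zero_iff.2 h0
      -- The point of the ball farthest in the direction `v`.
      have := key ((ε / ‖v‖) • v) (by
        rw [mem_closedBall_zero_iff, norm_smul, Real.norm_of_nonneg (by positivity),
          div_mul_cancel₀ _ hn])
      rw [inner_sub_left, inner_smul_left, real_inner_self_eq_norm_sq, conj_trivial,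
        show ε / ‖v‖ * ‖v‖ ^ 2 = ε * ‖v‖ by field_simp, real_inner_comm] at this
      linarith

/-! ### Assembly of both claims. -/

theorem theorem3 {d : ℕ} (μ₁ μ₂ : EuclideanSpace ℝ (Fin d)) (S : Matrix (Fin d) (Fin d) ℝ)
    (hS : S.PosSemidef) (ε : ℝ) (hε : 0 ≤ ε) :
    -- every linear classifier that minimizes the robust classification error
    (ε < ‖(2⁻¹ : ℝ) • (μ₁ - μ₂)‖ →
      ∀ c : LinearClassifier d, c.IsRobustBayesOptimal μ₁ μ₂ S ε →
        1 / 2 < c.accuracy μ₁ μ₂ S ∧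
        Integrable (fun p => c.scaledMargin μ₁ μ₂ p.1) (c.correctLaw μ₁ μ₂ S) ∧
        (c.accuracy μ₁ μ₂ S < 1 →
          tradeoffCurve (c.accuracy μ₁ μ₂ S) ≤ c.expectedScaledMargin μ₁ μ₂ S)) ∧
    -- the explicit classifier
    (∀ (r : ℕ) (F : Matrix (Fin d) (Fin r) ℝ) (l : Fin r → ℝ) (z : EuclideanSpace ℝ (Fin r)),
      IsThinEigendecomposition S F l →
      IsOptimalShift l ε (reducedMean μ₁ μ₂ F) z →
      ε < ‖reducedMean μ₁ μ₂ F‖ →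
        (μ₁ - μ₂ ∈ LinearMap.range S.toEuclideanLin →
          (shiftedClassifier μ₁ μ₂ F l z).IsRobustBayesOptimal μ₁ μ₂ S ε) ∧
        1 / 2 < (shiftedClassifier μ₁ μ₂ F l z).accuracy μ₁ μ₂ S ∧
        (shiftedClassifier μ₁ μ₂ F l z).accuracy μ₁ μ₂ S < 1 ∧
        Integrable (fun p => (shiftedClassifier μ₁ μ₂ F l z).scaledMargin μ₁ μ₂ p.1)
          ((shiftedClassifier μ₁ μ₂ F l z).correctLaw μ₁ μ₂ S) ∧
        tradeoffCurve ((shiftedClassifier μ₁ μ₂ F l z).accuracy μ₁ μ₂ S) ≤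
          (shiftedClassifier μ₁ μ₂ F l z).expectedScaledMargin μ₁ μ₂ S) := by

  refine ⟨fun hlt c hc => ?_, fun r F l z hF hz hlt => ?_⟩
  · obtain ⟨c₀, hc₀⟩ := LinearClassifier.exists_robustError_lt_half hS hε hlt
    have herr : c.robustError μ₁ μ₂ S ε < 1 / 2 := (hc c₀).trans_lt hc₀
    have hw := c.weight_ne_zero_of_robustError_lt_half hS hε herr
    have ha : 1 / 2 < c.accuracy μ₁ μ₂ S := by
      linarith [c.one_sub_robustError_le_accuracy (μ₁ := μ₁) (μ₂ := μ₂) hS hε]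
    refine ⟨ha, c.integrable_scaledMargin_correctLaw hw (by linarith), fun ha1 => ?_⟩
    rcases (c.spread_nonneg S).eq_or_lt with hσ | hσ
    · exact absurd (c.accuracy_eq_one_of_spread_eq_zero hS hε herr hσ.symm) ha1.ne
    · obtain ⟨hbal, hK⟩ := hc.eq_balanced hS hε herr hσ
      rw [hbal] at hσ ⊢
      exact (LinearClassifier.expectedScaledMargin_balanced hS hσ hK).ge
  · have hl := hF.eigenvalue_pos hS
    have hl0 : ∀ i, l i ≠ 0 := hF.2.2
    set m := reducedMean μ₁ μ₂ F with hm
    set v := (Matrix.diagonal l)⁻¹.toEuclideanLin (m - z) with hv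
    set c := shiftedClassifier μ₁ μ₂ F l z with hc
    have hcb : c = LinearClassifier.balanced μ₁ μ₂ (F.toEuclideanLin v) := rfl
    have hcw : c.weight = F.toEuclideanLin v := rfl
    have hzn : ‖z‖ ≤ ε := mem_closedBall_zero_iff.1 hz.1
    have hp : m - z ≠ 0 := fun h => by
      rw [sub_eq_zero.1 h] at hlt
      exact hlt.not_ge hzn
    have hpv : 0 < ⟪m - z, v⟫ := Matrix.inner_inv_diagonal_pos hl hp
    have hDv : (Matrix.diagonal l).toEuclideanLin v = m - z := by
      ext i
      rw [hv, Matrix.inv_diagonal_of_ne_zero hl0, Matrix.diagonal_toEuclideanLin_apply,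
        Matrix.diagonal_toEuclideanLin_apply, mul_inv_cancel_left₀ (hl0 i)]
    have hspread : c.spread S = √⟪m - z, v⟫ := by
      rw [hF.spread_eq, hcw, hF.transpose_apply_apply, hDv, real_inner_comm]
    have hσ : 0 < c.spread S := by
      rw [hspread]
      exact Real.sqrt_pos.2 hpv
    have hshift : ⟪v, z⟫ = ε * ‖v‖ := hz.inner_eq hl0 hε
    have hK : ⟪F.toEuclideanLin v, (2⁻¹ : ℝ) • (μ₁ - μ₂)⟫ = ⟪m - z, v⟫ + ε * ‖v‖ := by
      rw [Matrix.inner_toEuclideanLin_left, ← hshift, real_inner_comm v (m - z), ← inner_add_right,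
        sub_add_cancel]
      rfl
    have hKpos : 0 < ⟪F.toEuclideanLin v, (2⁻¹ : ℝ) • (μ₁ - μ₂)⟫ := by
      rw [hK]
      positivity
    have hacc := LinearClassifier.accuracy_balanced hS (hcb ▸ hσ)
    rw [← hcb] at hacc
    have ha : 1 / 2 < c.accuracy μ₁ μ₂ S := by
      rw [hacc, ← cdf_gaussianReal_zero]
      exact strictMono_cdf_gaussianReal (div_pos hKpos hσ)
    have hw : c.weight ≠ 0 := fun h => by
      rw [← hcw, h, inner_zero_left] at hKpos
      exact hKpos.false
    refine ⟨fun hμ c' => ?_, ha, ?_, c.integrable_scaledMargin_correctLaw hw (by linarith),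
      (LinearClassifier.expectedScaledMargin_balanced hS hσ hKpos).ge⟩
    · have hopt : c.robustError μ₁ μ₂ S ε = 1 - cdf (gaussianReal 0 1) (c.spread S) := by
        have := LinearClassifier.robustError_balanced (μ₁ := μ₁) (μ₂ := μ₂) hS hε
          (F.toEuclideanLin v)
        rw [← hcb, gaussianReal_real_affine_le _ _ hσ, hK, hF.norm_apply, add_sub_cancel_right,
          ← Real.mul_self_sqrt hpv.le, ← hspread, mul_div_cancel_right₀ _ hσ.ne'] at this
        exact this
      rw [hopt]
      refine c'.one_sub_cdf_le_robustError hS hε hσ.le ?_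
      -- Split `m = (m - z) + z`: the first part contributes at most the product of the two spreads,
      -- the second at most `ε‖w'‖`, with `w'` the weight of `c'`.
      have hcs := Matrix.inner_le_sqrt_mul_sqrt_inv_diagonal hl
        (F.transpose.toEuclideanLin c'.weight) (m - z)
      rw [← hF.spread_eq, ← hv, ← hspread, inner_sub_right] at hcs
      rw [← hF.apply_reducedMean hμ, real_inner_comm, Matrix.inner_toEuclideanLin_left,
        real_inner_comm, ← hm]
      have h1 := real_inner_le_norm (F.transpose.toEuclideanLin c'.weight) z
      have h2 := mul_le_mul (hF.norm_transpose_apply_le c'.weight) hzn (norm_nonneg z)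
        (norm_nonneg c'.weight)
      linarith
    · rw [hacc]
      exact cdf_gaussianReal_lt_one _
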